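/- Let $n\ge 2$ and $1\le i\le n-1$ be integers, and let $$ k=\begin{cases} n, & \text{if } i=1 \text{ or } i=n-1,\\ \lceil n/i\rceil+1, & \text{if } 1<i\le n/2,\\ \lceil n/(n-i)\rceil+1, & \text{if } n/2\le i<n-1. \end{cases} $$ For a linear subspace $H$ of $\mathbb{R}^n$, let $R_H$ denote the reflection in $H$, that is, $R_Hx=2P_Hx-x$, where $P_H$ is the orthogonal projection onto $H$; let $S^{n-1}$ be the unit sphere of $\mathbb{R}^n$. Then there exist $i$-dimensional linear subspaces $H_1,\dots,H_k$ of $\mathbb{R}^n$ such that all of the following hold. 1. If $E\subset S^{n-1}$ is nonempty, closed, and satisfies $R_{H_j}E=E$ for $j=1,\dots,k$, then $E=S^{n-1}$. 2. If $F\subset\mathbb{R}^n$ is closed and $R_{H_j}F=F$ for $j=1,\dots,k$, then $F$ is a union of spheres with centre at the origin (where the origin alone counts as a sphere of radius $0$, and the union may be empty). 3. If $K\subset\mathbb{R}^n$ is a convex body (a compact convex set with nonempty interior) and $R_{H_j}K=K$ for $j=1,\dots,k$, then $K$ is a closed ball of positive radius with centre at the origin. -/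

import Mathlib

/-- The number of `i`-dimensional subspaces of `ℝⁿ`, for `1 ≤ i ≤ n - 1`. -/
noncomputable def numReflections (n i : ℕ) : ℕ :=
  if i = 1 ∨ i + 1 = n then n
  else if (i : ℝ) ≤ (n : ℝ) / 2 then ⌈(n : ℝ) / (i : ℝ)⌉₊ + 1
  else ⌈(n : ℝ) / ((n : ℝ) - (i : ℝ))⌉₊ + 1

/-- First range of the case distinction. -/
theorem numReflections_of_eq {n i : ℕ} (h : i = 1 ∨ i + 1 = n) : numReflections n i = n := by
  simp [numReflections, h]

/-- Second range of the case distinction. -/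
theorem numReflections_of_le {n i : ℕ} (h1 : 1 < i) (h2 : (i : ℝ) ≤ (n : ℝ) / 2) :
    numReflections n i = ⌈(n : ℝ) / (i : ℝ)⌉₊ + 1 := by
  have h3 : 2 * i ≤ n := by
    have : (2 : ℝ) * i ≤ n := by linarith
    exact_mod_cast this
  have h4 : ¬ (i = 1 ∨ i + 1 = n) := by omega
  simp only [numReflections, if_neg h4, if_pos h2]

/-- Third range of the case distinction; at `i = n / 2` it agrees with the second. -/
theorem numReflections_of_ge {n i : ℕ} (h1 : (n : ℝ) / 2 ≤ (i : ℝ)) (h2 : i + 1 < n) :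
    numReflections n i = ⌈(n : ℝ) / ((n : ℝ) - (i : ℝ))⌉₊ + 1 := by
  have h3 : n ≤ 2 * i := by
    have : (n : ℝ) ≤ 2 * i := by linarith
    exact_mod_cast this
  have h4 : ¬ (i = 1 ∨ i + 1 = n) := by omega
  simp only [numReflections, if_neg h4]
  split_ifs with h
  · have h5 : (n : ℝ) - i = i := by linarith
    rw [h5]
  · rfl

/-- `X` is invariant under the orthogonal reflection `x ↦ 2 (x|H) - x` in the subspace `H`. -/
def IsReflectionInvariant {n : ℕ} (H : Submodule ℝ (EuclideanSpace ℝ (Fin n)))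
    (X : Set (EuclideanSpace ℝ (Fin n))) : Prop :=
  H.reflection '' X = X

/-- `X` is a union of spheres with centre at the origin; the radius `0`, for which the sphere is
the single point `o`, is allowed. -/
def IsUnionOfCentredSpheres {n : ℕ} (X : Set (EuclideanSpace ℝ (Fin n))) : Prop :=
  ∃ S : Set ℝ, (∀ r ∈ S, 0 ≤ r) ∧ X = ⋃ r ∈ S, Metric.sphere 0 r

/-! Reflections in a subspace and in its orthogonal complement differ by the factor `-1`, so it
suffices to work with `m = min i (n - i)` and a sign `ε`. Cut the coordinates into blocks of length
`m`. The first mirror is spanned by block 0; the `j`-th is block 0 tilted towards block `j`, the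
`t`-th basis vector by the angle `π α t`. The product of these two reflections rotates `m`
orthogonal planes simultaneously by `2π α t`. If the multiples of `α` are dense modulo `ℤᵐ`,
closedness of an invariant set yields invariance under every rotation of each single plane
(`planesRotation_mem`). These rotations only link coordinates with the same position in their
blocks. For `m ≥ 2` one more mirror, containing a vector that mixes positions, links the classes;
for `m = 1` there is only one class, and `n` mirrors suffice. Maximizing the square of coordinate 0
then shows that every nonempty closed invariant subset of the sphere contains one fixed basis vector
(`single_mem_of_coordRotation_mem`), and a distance argument upgrades this to the whole sphere
(`eq_sphere_of_forall_mem`). The statements on closed sets and convex bodies follow by scaling and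
convexity. -/

/-- Some vector of `ℝᵏ` has integer multiples that are dense modulo `ℤᵏ`. -/
theorem exists_dense_multiples (ι : Type*) [Fintype ι] :
    ∃ a : ι → ℝ, ∀ U : Set (ι → ℝ), IsOpen U → U.Nonempty →
      ∃ (k : ℕ) (z : ι → ℤ), (fun t => k * a t + z t) ∈ U := by
  -- Baire category: the vectors with some multiple in `U` modulo the integers form a dense open
  -- set, and countably many basic `U` suffice.
  let D : Set (ι → ℝ) → Set (ι → ℝ) := fun U =>
    ⋃ (k : ℕ) (z : ι → ℤ), (fun a : ι → ℝ => fun t => k * a t + z t) ⁻¹' U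
  have hDo : ∀ U, IsOpen U → IsOpen (D U) := fun U hU =>
    isOpen_iUnion fun k => isOpen_iUnion fun z => hU.preimage (by fun_prop)
  have hDd : ∀ U : Set (ι → ℝ), U.Nonempty → Dense (D U) := by
    rintro U ⟨u, hu⟩
    rw [Metric.dense_iff]
    intro a r hr
    obtain ⟨k, hk⟩ := exists_nat_gt (1 / r)
    have hk0 : (0 : ℝ) < k := lt_trans (by positivity) hk
    -- The points `(u + z) / k` with `z` integral form a grid of mesh `1 / k < r`; this is the one
    -- just below `a`.
    refine ⟨fun t => (u t + ⌊k * a t - u t⌋) / k, ?_, ?_⟩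
    · rw [Metric.mem_ball, dist_pi_lt_iff hr]
      intro t
      have h1 := Int.floor_le (k * a t - u t)
      have h2 := Int.lt_floor_add_one (k * a t - u t)
      have h3 : 1 < k * r := by rwa [div_lt_iff₀ hr] at hk
      have h4 : (u t + ⌊k * a t - u t⌋) / k - a t = (u t + ⌊k * a t - u t⌋ - k * a t) / k := by
        field_simp
      rw [Real.dist_eq, h4, abs_div, abs_of_pos hk0, div_lt_iff₀ hk0, abs_lt]
      constructor <;> nlinarith
    · simp only [D, Set.mem_iUnion, Set.mem_preimage]
      refine ⟨k, fun t => -⌊k * a t - u t⌋, ?_⟩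
      convert hu using 1
      ext t
      field_simp
      push_cast
      ring
  have hB := TopologicalSpace.isBasis_countableBasis (ι → ℝ)
  obtain ⟨a, ha⟩ := (dense_biInter_of_isOpen
    (S := TopologicalSpace.countableBasis (ι → ℝ)) (f := D) (fun U hU => hDo U (hB.isOpen hU))
    (TopologicalSpace.countable_countableBasis _)
    (fun U hU => hDd U (TopologicalSpace.nonempty_of_mem_countableBasis hU))).nonempty
  refine ⟨a, fun U hU ⟨u, hu⟩ => ?_⟩
  obtain ⟨V, hV, -, hVU⟩ := hB.exists_subset_of_mem_open hu hU
  have h := Set.mem_iInter₂.1 ha V hV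
  simp only [D, Set.mem_iUnion, Set.mem_preimage] at h
  obtain ⟨k, z, h⟩ := h
  exact ⟨k, z, hVU h⟩

/-! ### Simultaneous rotations of orthogonal planes as products of two reflections -/

section PlanesRotation

variable {V ι : Type*} [NormedAddCommGroup V] [InnerProductSpace ℝ V]

theorem orthonormal_cos_smul_add_sin_smul {a b : ι → V} (h : Orthonormal ℝ (Sum.elim a b))
    (θ : ι → ℝ) : Orthonormal ℝ fun i => Real.cos (θ i) • a i + Real.sin (θ i) • b i := by
  classical
  rw [orthonormal_iff_ite] at h ⊢
  have haa : ∀ i j, inner ℝ (a i) (a j) = if i = j then (1 : ℝ) else 0 := fun i j => by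
    simpa using h (.inl i) (.inl j)
  have hab : ∀ i j, inner ℝ (a i) (b j) = (0 : ℝ) := fun i j => by
    simpa using h (.inl i) (.inr j)
  have hbb : ∀ i j, inner ℝ (b i) (b j) = if i = j then (1 : ℝ) else 0 := fun i j => by
    simpa using h (.inr i) (.inr j)
  have hba : ∀ i j, inner ℝ (b i) (a j) = (0 : ℝ) := fun i j => by
    simpa using h (.inr i) (.inl j)
  intro i j
  simp only [inner_add_left, inner_add_right, inner_smul_left, inner_smul_right, haa, hab, hba,
    hbb, conj_trivial]
  split_ifs with hij
  · subst hij
    linear_combination Real.cos_sq_add_sin_sq (θ i)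
  · simp

variable [Fintype ι]

/-- The simultaneous rotation, by the angles `φ i`, of the planes spanned by `a i` and `b i`. -/
noncomputable def planesRotation (a b : ι → V) (φ : ι → ℝ) (x : V) : V :=
  x + ∑ i, (((Real.cos (φ i) - 1) * inner ℝ (a i) x - Real.sin (φ i) * inner ℝ (b i) x) • a i +
    (Real.sin (φ i) * inner ℝ (a i) x + (Real.cos (φ i) - 1) * inner ℝ (b i) x) • b i)

theorem continuous_planesRotation (a b : ι → V) (x : V) :
    Continuous fun φ => planesRotation a b φ x := by
  unfold planesRotation
  fun_prop

@[simp]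
theorem planesRotation_zero (a b : ι → V) (x : V) : planesRotation a b 0 x = x := by
  simp [planesRotation]

theorem planesRotation_add_int_mul (a b : ι → V) (φ : ι → ℝ) (z : ι → ℤ) (x : V) :
    planesRotation a b (fun i => φ i + z i * (2 * Real.pi)) x = planesRotation a b φ x := by
  simp [planesRotation, Real.cos_add_int_mul_two_pi, Real.sin_add_int_mul_two_pi]

theorem planesRotation_single [DecidableEq ι] (a b : ι → V) (i : ι) (φ : ℝ) (x : V) :
    planesRotation a b (Pi.single i φ) x =
      x + (((Real.cos φ - 1) * inner ℝ (a i) x - Real.sin φ * inner ℝ (b i) x) • a i +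
        (Real.sin φ * inner ℝ (a i) x + (Real.cos φ - 1) * inner ℝ (b i) x) • b i) := by
  unfold planesRotation
  rw [Finset.sum_eq_single i]
  · simp
  · intro j _ hj
    simp [Pi.single_eq_of_ne hj]
  · simp

theorem inner_left_planesRotation {a b : ι → V} (h : Orthonormal ℝ (Sum.elim a b)) (φ : ι → ℝ)
    (x : V) (i : ι) : inner ℝ (a i) (planesRotation a b φ x) =
      Real.cos (φ i) * inner ℝ (a i) x - Real.sin (φ i) * inner ℝ (b i) x := by
  classical
  rw [orthonormal_iff_ite] at h
  have haa : ∀ j, inner ℝ (a i) (a j) = if i = j then (1 : ℝ) else 0 := fun j => by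
    simpa using h (.inl i) (.inl j)
  have hab : ∀ j, inner ℝ (a i) (b j) = (0 : ℝ) := fun j => by
    simpa using h (.inl i) (.inr j)
  simp [planesRotation, inner_add_right, inner_sum, inner_smul_right, haa, hab]
  ring

theorem inner_right_planesRotation {a b : ι → V} (h : Orthonormal ℝ (Sum.elim a b)) (φ : ι → ℝ)
    (x : V) (i : ι) : inner ℝ (b i) (planesRotation a b φ x) =
      Real.sin (φ i) * inner ℝ (a i) x + Real.cos (φ i) * inner ℝ (b i) x := by
  classical
  rw [orthonormal_iff_ite] at h
  have hbb : ∀ j, inner ℝ (b i) (b j) = if i = j then (1 : ℝ) else 0 := fun j => by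
    simpa using h (.inr i) (.inr j)
  have hba : ∀ j, inner ℝ (b i) (a j) = (0 : ℝ) := fun j => by
    simpa using h (.inr i) (.inl j)
  simp [planesRotation, inner_add_right, inner_sum, inner_smul_right, hbb, hba]
  ring

theorem planesRotation_planesRotation {a b : ι → V} (h : Orthonormal ℝ (Sum.elim a b))
    (φ ψ : ι → ℝ) (x : V) :
    planesRotation a b φ (planesRotation a b ψ x) = planesRotation a b (φ + ψ) x := by
  conv_lhs => rw [planesRotation]
  simp only [inner_left_planesRotation h, inner_right_planesRotation h]
  rw [planesRotation, planesRotation, add_assoc, ← Finset.sum_add_distrib]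
  congr 1
  refine Finset.sum_congr rfl fun i _ => ?_
  simp only [Pi.add_apply, Real.cos_add, Real.sin_add]
  module

theorem reflection_span_range_apply {v : ι → V} (hv : Orthonormal ℝ v)
    [(Submodule.span ℝ (Set.range v)).HasOrthogonalProjection] (x : V) :
    (Submodule.span ℝ (Set.range v)).reflection x = (∑ i, (2 * inner ℝ (v i) x) • v i) - x := by
  classical
  have hp : (Submodule.span ℝ (Set.range v)).starProjection x = ∑ i, inner ℝ (v i) x • v i := by
    refine Submodule.eq_starProjection_of_mem_of_inner_eq_zero ?_ ?_
    · exact Submodule.sum_mem _ fun i _ =>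
        Submodule.smul_mem _ _ (Submodule.subset_span ⟨i, rfl⟩)
    · intro w hw
      induction hw using Submodule.span_induction with
      | mem w hw =>
        obtain ⟨j, rfl⟩ := hw
        rw [real_inner_comm, inner_sub_right, hv.inner_right_fintype, sub_self]
      | zero => simp
      | add w₁ w₂ _ _ h₁ h₂ => rw [inner_add_right, h₁, h₂, add_zero]
      | smul c w _ h => rw [inner_smul_right, h, mul_zero]
  rw [Submodule.reflection_apply, hp, Finset.smul_sum]
  simp only [mul_smul, two_smul]

/-- In each plane two line reflections compose to a rotation by twice the angle between the lines;
on the orthogonal complement of all the planes both reflections are `-1` and cancel. -/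
theorem reflection_comp_reflection {a b : ι → V} (h : Orthonormal ℝ (Sum.elim a b)) (θ : ι → ℝ)
    [(Submodule.span ℝ (Set.range a)).HasOrthogonalProjection]
    [(Submodule.span ℝ (Set.range
      fun i => Real.cos (θ i) • a i + Real.sin (θ i) • b i)).HasOrthogonalProjection] (x : V) :
    (Submodule.span ℝ (Set.range
      fun i => Real.cos (θ i) • a i + Real.sin (θ i) • b i)).reflection
        ((Submodule.span ℝ (Set.range a)).reflection x) =
      planesRotation a b (fun i => 2 * θ i) x := by
  classical
  have ha : Orthonormal ℝ a := h.comp Sum.inl Sum.inl_injective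
  have hab : ∀ i j, inner ℝ (b i) (a j) = (0 : ℝ) := fun i j => by
    simpa using (orthonormal_iff_ite.1 h) (.inr i) (.inl j)
  rw [reflection_span_range_apply (orthonormal_cos_smul_add_sin_smul h θ),
    reflection_span_range_apply ha]
  have h1 : ∀ i, inner ℝ (a i) (∑ j, (2 * inner ℝ (a j) x) • a j - x) = inner ℝ (a i) x := by
    intro i
    rw [inner_sub_right, ha.inner_right_fintype]
    ring
  have h2 : ∀ i, inner ℝ (b i) (∑ j, (2 * inner ℝ (a j) x) • a j - x) = -inner ℝ (b i) x := by
    intro i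
    simp [inner_sub_right, inner_sum, inner_smul_right, hab]
  simp only [inner_add_left, inner_smul_left, h1, h2, conj_trivial]
  have key : ∑ i, (2 * (Real.cos (θ i) * inner ℝ (a i) x + Real.sin (θ i) * -inner ℝ (b i) x)) •
      (Real.cos (θ i) • a i + Real.sin (θ i) • b i) - ∑ i, (2 * inner ℝ (a i) x) • a i =
      planesRotation a b (fun i => 2 * θ i) x - x := by
    rw [planesRotation, add_sub_cancel_left, ← Finset.sum_sub_distrib]
    refine Finset.sum_congr rfl fun i _ => ?_
    rw [Real.cos_two_mul, Real.sin_two_mul]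
    match_scalars
    · ring
    · linear_combination (-2 * inner ℝ (b i) x) * Real.sin_sq_add_cos_sq (θ i)
  rw [← sub_add, key, sub_add_cancel]

end PlanesRotation

theorem planesRotation_mem {V ι : Type*} [NormedAddCommGroup V] [InnerProductSpace ℝ V] [Fintype ι]
    {a b : ι → V} (h : Orthonormal ℝ (Sum.elim a b)) {α : ι → ℝ}
    (hα : ∀ U : Set (ι → ℝ), IsOpen U → U.Nonempty →
      ∃ (k : ℕ) (z : ι → ℤ), (fun t => k * α t + z t) ∈ U)
    {E : Set V} (hE : IsClosed E)
    (hrot : ∀ x ∈ E, planesRotation a b (fun i => 2 * (Real.pi * α i)) x ∈ E)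
    (φ : ι → ℝ) {x : V} (hx : x ∈ E) : planesRotation a b φ x ∈ E := by
  have hpow : ∀ k : ℕ, planesRotation a b (fun i => k * (2 * (Real.pi * α i))) x ∈ E := by
    intro k
    induction k with
    | zero =>
      simp only [Nat.cast_zero, zero_mul]
      rwa [← Pi.zero_def, planesRotation_zero]
    | succ k ih =>
      convert hrot _ ih using 1
      rw [planesRotation_planesRotation h]
      congr 1
      ext i
      push_cast [Pi.add_apply]
      ring
  by_contra hφ
  -- With angles measured in full turns, the rotations that move `x` out of `E` form an open set.
  -- Were it nonempty, it would contain a multiple of `α` modulo the integers, contradicting `hpow`.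
  obtain ⟨k, z, hkz⟩ := hα {β | planesRotation a b (fun i => 2 * Real.pi * β i) x ∉ E}
    (hE.isOpen_compl.preimage (f := fun β : ι → ℝ => planesRotation a b (fun i => 2 * Real.pi * β i) x)
      ((continuous_planesRotation a b x).comp (by fun_prop)))
    ⟨fun i => φ i / (2 * Real.pi), by
      have : (fun i => 2 * Real.pi * (φ i / (2 * Real.pi))) = φ := by
        ext i
        field_simp
      simpa only [Set.mem_ofPred_eq, this] using hφ⟩
  refine hkz ?_
  have hk := hpow k
  rw [← planesRotation_add_int_mul a b _ z] at hk
  convert hk using 3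
  ring

/-! ### Coordinate rotations and the maximization argument -/

/-- The rotation by the angle `α` of the plane of the coordinates `t` and `c`. -/
noncomputable def coordRotation {n : ℕ} (t c : Fin n) (α : ℝ) (x : EuclideanSpace ℝ (Fin n)) :
    EuclideanSpace ℝ (Fin n) :=
  x + (((Real.cos α - 1) * x t - Real.sin α * x c) • EuclideanSpace.single t 1 +
    (Real.sin α * x t + (Real.cos α - 1) * x c) • EuclideanSpace.single c 1)

section CoordRotation

variable {n : ℕ} {t c : Fin n} (α : ℝ) (x : EuclideanSpace ℝ (Fin n))

theorem coordRotation_apply_left (h : t ≠ c) :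
    coordRotation t c α x t = Real.cos α * x t - Real.sin α * x c := by
  simp [coordRotation, h]
  ring

theorem coordRotation_apply_right (h : t ≠ c) :
    coordRotation t c α x c = Real.sin α * x t + Real.cos α * x c := by
  simp [coordRotation, h.symm]
  ring

theorem coordRotation_apply_of_ne {d : Fin n} (ht : d ≠ t) (hc : d ≠ c) :
    coordRotation t c α x d = x d := by
  simp [coordRotation, ht, hc]

end CoordRotation

theorem exists_cos_mul_sub_sin_mul_sq_eq (s t : ℝ) :
    ∃ α : ℝ, (Real.cos α * s - Real.sin α * t) ^ 2 = s ^ 2 + t ^ 2 := by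
  -- The conjugate of `s + t * I`: rotating by its argument turns `(s, t)` onto the first axis.
  let z : ℂ := ⟨s, -t⟩
  refine ⟨Complex.arg z, ?_⟩
  have h1 : ‖z‖ * Real.cos (Complex.arg z) = s := Complex.norm_mul_cos_arg z
  have h2 : ‖z‖ * Real.sin (Complex.arg z) = -t := Complex.norm_mul_sin_arg z
  have h3 := Real.sin_sq_add_cos_sq (Complex.arg z)
  have h4 : t = -(‖z‖ * Real.sin (Complex.arg z)) := by linarith
  rw [h4, ← h1]
  linear_combination (‖z‖ ^ 2 * (Real.sin z.arg ^ 2 + Real.cos z.arg ^ 2)) * h3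

/-- A closed subset of the sphere that has enough rotational symmetries contains the basis vector
with index `o`. -/
theorem single_mem_of_coordRotation_mem {n : ℕ} {E : Set (EuclideanSpace ℝ (Fin n))}
    (hsub : E ⊆ Metric.sphere 0 1) (hne : E.Nonempty) (hE : IsClosed E)
    {o p : Fin n} {T : Finset (Fin n)} (hoT : o ∉ T) {L : Fin n → Fin n → Prop}
    (hLne : ∀ t c, L t c → t ≠ c ∧ o ≠ c)
    (hL : ∀ t c, L t c → ∀ α, ∀ x ∈ E, coordRotation t c α x ∈ E)
    (hop : L o p) (hT : ∀ t ∈ T, ∃ c ∉ T, L t c)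
    (hcov : ∀ c, c ≠ o → L o c ∨ c ∈ T ∨ ∃ t ∈ T, L t c)
    (hR : T.Nonempty → ∃ κ : ℝ, κ ≠ 0 ∧ ∀ x ∈ E, x p = 0 →
      ∃ y ∈ E, y o ^ 2 = x o ^ 2 ∧ y p = κ * ∑ t ∈ T, x t) :
    EuclideanSpace.single o 1 ∈ E := by
  have hcomp : IsCompact E := (isCompact_sphere _ _).of_isClosed_subset hE hsub
  obtain ⟨x₀, hx₀, hmax⟩ := hcomp.exists_isMaxOn hne
    (f := fun x : EuclideanSpace ℝ (Fin n) => x o ^ 2) (by fun_prop)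
  have hle : ∀ x ∈ E, x o ^ 2 ≤ x₀ o ^ 2 := fun x hx => hmax hx
  -- At a maximizer a nonzero `x c` could be rotated into coordinate `o`, increasing its square.
  have h1 : ∀ x ∈ E, x o ^ 2 = x₀ o ^ 2 → ∀ c, L o c → x c = 0 := by
    intro x hx hxo c hc
    obtain ⟨α, hα⟩ := exists_cos_mul_sub_sin_mul_sq_eq (x o) (x c)
    have h := hle _ (hL o c hc α x hx)
    rw [coordRotation_apply_left _ _ (hLne o c hc).1, hα, hxo] at h
    exact pow_eq_zero_iff (two_ne_zero) |>.1 (le_antisymm (by linarith) (sq_nonneg _))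
  have h2 : ∀ t ∈ T, ∀ c, L t c → ∀ α x, coordRotation t c α x o = x o := by
    intro t ht c hc α x
    exact coordRotation_apply_of_ne α x (by rintro rfl; exact hoT ht) (hLne t c hc).2
  -- The map in `hR` sends maximizers to maximizers and puts a nonzero multiple of this sum into
  -- coordinate `p`, where `h1` applies.
  have h3 : ∀ x ∈ E, x o ^ 2 = x₀ o ^ 2 → ∑ t ∈ T, x t = 0 := by
    intro x hx hxo
    rcases T.eq_empty_or_nonempty with rfl | hTne
    · simp
    · obtain ⟨κ, hκ, h⟩ := hR hTne
      obtain ⟨y, hy, hyo, hyp⟩ := h x hx (h1 x hx hxo p hop)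
      have := h1 y hy (hyo.trans hxo) p hop
      rw [hyp] at this
      exact (mul_eq_zero.1 this).resolve_left hκ
  have h4 : ∀ x ∈ E, x o ^ 2 = x₀ o ^ 2 → ∀ t ∈ T, x t = 0 := by
    intro x hx hxo t ht
    obtain ⟨c, hcT, hc⟩ := hT t ht
    -- A half turn flips the sign of `x t` and, as `c ∉ T`, fixes the other summands; comparing the
    -- two vanishing sums isolates `x t`.
    have h := h3 _ (hL t c hc Real.pi x hx) (by rw [h2 t ht c hc, hxo])
    have hsum : ∑ d ∈ T.erase t, coordRotation t c Real.pi x d = ∑ d ∈ T.erase t, x d :=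
      Finset.sum_congr rfl fun d hd => coordRotation_apply_of_ne Real.pi x
        (Finset.ne_of_mem_erase hd) fun hdc => hcT (hdc ▸ Finset.mem_of_mem_erase hd)
    rw [← Finset.add_sum_erase T _ ht, coordRotation_apply_left _ _ (hLne t c hc).1, hsum] at h
    have h' := h3 x hx hxo
    rw [← Finset.add_sum_erase T _ ht] at h'
    simp at h
    linarith
  have h5 : ∀ c, c ≠ o → x₀ c = 0 := by
    intro c hco
    rcases hcov c hco with hc | hc | ⟨t, ht, hc⟩
    · exact h1 x₀ hx₀ rfl c hc
    · exact h4 x₀ hx₀ rfl c hc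
    -- A quarter turn moves `x₀ c`, up to sign, into coordinate `t`.
    · have h := h4 _ (hL t c hc (Real.pi / 2) x₀ hx₀) (by rw [h2 t ht c hc]) t ht
      rw [coordRotation_apply_left _ _ (hLne t c hc).1] at h
      simpa using h
  have h6 : x₀ o ^ 2 = 1 := by
    have h : ‖x₀‖ = 1 := by simpa using hsub hx₀
    have h' := EuclideanSpace.real_norm_sq_eq x₀
    rw [Finset.sum_eq_single o (fun c _ hc => by rw [h5 c hc]; simp) (by simp), h] at h'
    linarith
  rcases sq_eq_sq_iff_eq_or_eq_neg.1 (h6.trans (one_pow 2).symm) with h | h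
  · convert hx₀ using 1
    ext c
    by_cases hc : c = o
    · subst hc; simp [h]
    · simp [h5 c hc, hc]
  · convert hL o p hop Real.pi x₀ hx₀ using 1
    have hop' := (hLne o p hop).1
    ext c
    by_cases hc : c = o
    · subst hc; simp [coordRotation_apply_left _ _ hop', h]
    · by_cases hcp : c = p
      · subst hcp; simp [coordRotation_apply_right _ _ hop', h5 c hc, hc]
      · simp [coordRotation_apply_of_ne _ _ hc hcp, h5 c hc, hc]

/-! ### From one common point to spheres, closed sets and convex bodies -/

section Invariant

variable {n : ℕ} {H : Submodule ℝ (EuclideanSpace ℝ (Fin n))} {X : Set (EuclideanSpace ℝ (Fin n))}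

theorem isReflectionInvariant_iff :
    IsReflectionInvariant H X ↔ ∀ x ∈ X, H.reflection x ∈ X := by
  refine ⟨fun h x hx => h ▸ Set.mem_image_of_mem _ hx, fun h => ?_⟩
  refine Set.Subset.antisymm (Set.image_subset_iff.2 h) fun x hx => ?_
  exact ⟨_, h x hx, H.reflection_reflection x⟩

/-- If every nonempty closed invariant subset of the unit sphere contains a given point, then the
sphere is the only such set. -/
theorem eq_sphere_of_forall_mem {ι : Type*} {H : ι → Submodule ℝ (EuclideanSpace ℝ (Fin n))}
    {p : EuclideanSpace ℝ (Fin n)}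
    (hp : ∀ E : Set (EuclideanSpace ℝ (Fin n)), E ⊆ Metric.sphere 0 1 → E.Nonempty → IsClosed E →
      (∀ j, IsReflectionInvariant (H j) E) → p ∈ E)
    {E : Set (EuclideanSpace ℝ (Fin n))} (hsub : E ⊆ Metric.sphere 0 1) (hne : E.Nonempty)
    (hE : IsClosed E) (hinv : ∀ j, IsReflectionInvariant (H j) E) : E = Metric.sphere 0 1 := by
  refine Set.Subset.antisymm hsub fun y hy => ?_
  have hpE := hp E hsub hne hE hinv
  -- The points of the sphere at least as far from `E` as `y` again form a closed invariant set,
  -- nonempty because of `y`. It contains `p`, whose distance from `E` is zero, so `y` has distance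
  -- zero too.
  have hpF := hp {x | x ∈ Metric.sphere 0 1 ∧ Metric.infDist y E ≤ Metric.infDist x E}
    (fun x hx => hx.1) ⟨y, hy, le_rfl⟩
    (Metric.isClosed_sphere.inter
      (isClosed_le continuous_const (Metric.continuous_infDist_pt E))) (fun j => by
      rw [isReflectionInvariant_iff]
      rintro x ⟨hx, hxE⟩
      refine ⟨by simpa using hx, hxE.trans (le_of_eq ?_)⟩
      conv_rhs => rw [← hinv j]
      exact (Metric.infDist_image (H j).reflection.isometry).symm)
  rw [hE.mem_iff_infDist_zero hne]
  refine le_antisymm (hpF.2.trans (le_of_eq ?_)) Metric.infDist_nonneg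
  exact (hE.mem_iff_infDist_zero hne).1 hpE

theorem isUnionOfCentredSpheres_of_eq_sphere {ι : Type*}
    {H : ι → Submodule ℝ (EuclideanSpace ℝ (Fin n))}
    (hH : ∀ E : Set (EuclideanSpace ℝ (Fin n)), E ⊆ Metric.sphere 0 1 → E.Nonempty → IsClosed E →
      (∀ j, IsReflectionInvariant (H j) E) → E = Metric.sphere 0 1)
    {F : Set (EuclideanSpace ℝ (Fin n))} (hF : IsClosed F)
    (hinv : ∀ j, IsReflectionInvariant (H j) F) : IsUnionOfCentredSpheres F := by
  have key : ∀ x ∈ F, Metric.sphere 0 ‖x‖ ⊆ F := by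
    intro x hx y hy
    have hy' : ‖y‖ = ‖x‖ := by simpa using hy
    rcases eq_or_ne x 0 with rfl | hx0
    · have : y = 0 := by simpa using hy'
      rwa [this]
    · have hr : ‖x‖ ≠ 0 := norm_ne_zero_iff.2 hx0
      -- The slice of `F` at radius `‖x‖`, rescaled to the unit sphere; linearity of reflections
      -- keeps it invariant.
      have hE := hH {z | z ∈ Metric.sphere 0 1 ∧ ‖x‖ • z ∈ F} (fun z hz => hz.1)
        ⟨‖x‖⁻¹ • x, by simp [norm_smul, hr], by simpa [smul_smul, hr] using hx⟩
        (Metric.isClosed_sphere.inter (hF.preimage (continuous_const_smul ‖x‖))) (fun j => by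
          rw [isReflectionInvariant_iff]
          rintro z ⟨hz, hzF⟩
          refine ⟨by simpa using hz, ?_⟩
          rw [← map_smul]
          exact isReflectionInvariant_iff.1 (hinv j) _ hzF)
      have hmem : ‖x‖⁻¹ • y ∈ Metric.sphere (0 : EuclideanSpace ℝ (Fin n)) 1 := by
        simp [norm_smul, hy', hr]
      rw [← hE] at hmem
      simpa [smul_smul, hr] using hmem.2
  refine ⟨(‖·‖) '' F, by rintro _ ⟨x, -, rfl⟩; exact norm_nonneg x, Set.Subset.antisymm ?_ ?_⟩
  · intro x hx
    exact Set.mem_iUnion₂.2 ⟨‖x‖, ⟨x, hx, rfl⟩, by simp⟩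
  · rintro y hy
    obtain ⟨_, ⟨x, hx, rfl⟩, hy⟩ := Set.mem_iUnion₂.1 hy
    exact key x hx hy

theorem IsUnionOfCentredSpheres.eq_closedBall (hn : 1 ≤ n) (hX : IsUnionOfCentredSpheres X)
    (hc : IsCompact X) (hconv : Convex ℝ X) (hint : (interior X).Nonempty) :
    ∃ r : ℝ, 0 < r ∧ X = Metric.closedBall 0 r := by
  have : NeZero n := ⟨by omega⟩
  have key : ∀ x ∈ X, ∀ y : EuclideanSpace ℝ (Fin n), ‖y‖ = ‖x‖ → y ∈ X := by
    obtain ⟨S, -, rfl⟩ := hX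
    intro x hx y hy
    obtain ⟨r, hr, hx⟩ := Set.mem_iUnion₂.1 hx
    exact Set.mem_iUnion₂.2 ⟨r, hr, by simpa [hy] using hx⟩
  obtain ⟨x, hx, hmax⟩ := hc.exists_isMaxOn (hint.mono interior_subset) continuous_norm.continuousOn
  have hle : ∀ y ∈ X, ‖y‖ ≤ ‖x‖ := fun y hy => hmax hy
  have hpos : 0 < ‖x‖ := by
    by_contra h
    have hX0 : X ⊆ {0} := fun y hy => by
      have := hle y hy
      exact norm_le_zero_iff.1 (by linarith)
    have := hint.mono (interior_mono hX0)
    rw [interior_singleton] at this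
    exact Set.not_nonempty_empty this
  refine ⟨‖x‖, hpos, Set.Subset.antisymm (fun y hy => by simpa using hle y hy) fun y hy => ?_⟩
  have hy' : ‖y‖ ≤ ‖x‖ := by simpa using hy
  -- `y` lies on the segment between the antipodal points `±‖x‖ • u` of `X`. For `y = 0` any unit
  -- vector serves, which needs `n ≥ 1`.
  obtain ⟨u, hu, hyu⟩ : ∃ u : EuclideanSpace ℝ (Fin n), ‖u‖ = 1 ∧ y = ‖y‖ • u := by
    rcases eq_or_ne y 0 with rfl | h0
    · exact ⟨EuclideanSpace.single 0 1, by simp, by simp⟩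
    · have : ‖y‖ ≠ 0 := norm_ne_zero_iff.2 h0
      exact ⟨‖y‖⁻¹ • y, by simp [norm_smul, this], by simp [smul_smul, this]⟩
  have h1 := key x hx (‖x‖ • u) (by simp [norm_smul, hu])
  have h2 := key x hx (-(‖x‖ • u)) (by simp [norm_smul, hu])
  have h3 : 0 ≤ (1 + ‖y‖ / ‖x‖) / 2 := by positivity
  have h4 : 0 ≤ (1 - ‖y‖ / ‖x‖) / 2 := by
    have := div_le_one_of_le₀ hy' hpos.le
    linarith
  convert hconv h1 h2 h3 h4 (by ring) using 1
  conv_lhs => rw [hyu]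
  match_scalars
  field_simp
  ring

end Invariant

/-! ### The mirrors and the verification of the maximization hypotheses -/

section Construction

variable {n m : ℕ}

/-- The indices of the `j`-th block of `m` coordinates; blocks that would reach beyond `n` are
shifted back to the last `m` coordinates. -/
def blockIndex (h : 2 * m ≤ n) (j : ℕ) (t : Fin m) : Fin n :=
  ⟨min (j * m) (n - m) + t, by have := t.2; omega⟩

/-- The basis vectors with indices in the `j`-th block. -/
noncomputable def blockVector (h : 2 * m ≤ n) (j : ℕ) (t : Fin m) : EuclideanSpace ℝ (Fin n) :=
  EuclideanSpace.single (blockIndex h j t) 1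

/-- Even a shifted block starts at `n - m ≥ m` and so avoids block 0. -/
theorem orthonormal_blockVector (h : 2 * m ≤ n) {j : ℕ} (hj : j ≠ 0) :
    Orthonormal ℝ (Sum.elim (blockVector h 0) (blockVector h j)) := by
  have hinj : Function.Injective (Sum.elim (blockIndex h 0) (blockIndex h j)) := by
    have hjm : m ≤ j * m := Nat.le_mul_of_pos_left m (Nat.pos_of_ne_zero hj)
    rintro (s | s) (t | t) hst <;> have hs := s.2 <;> have ht := t.2 <;>
      simp only [Sum.elim_inl, Sum.elim_inr, blockIndex, Fin.mk.injEq] at hst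
    · congr 1; ext; omega
    · omega
    · omega
    · congr 1; ext; omega
  have hcomp : Sum.elim (blockVector h 0) (blockVector h j) =
      EuclideanSpace.basisFun (Fin n) ℝ ∘ Sum.elim (blockIndex h 0) (blockIndex h j) := by
    funext t
    rcases t with t | t <;> simp [blockVector]
  rw [hcomp]
  exact (EuclideanSpace.basisFun (Fin n) ℝ).orthonormal.comp _ hinj

/-- The normalized sum of the basis vectors with indices `1, …, m`. -/
noncomputable def mixingVector (n m : ℕ) : EuclideanSpace ℝ (Fin n) :=
  WithLp.toLp 2 fun c => if 1 ≤ c.val ∧ c.val ≤ m then (√m)⁻¹ else 0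

/-- The mixing vector and the basis vectors with indices `m + 1, …, 2 * m - 1`. -/
noncomputable def mixingFamily (h : 2 * m ≤ n) (t : Fin m) : EuclideanSpace ℝ (Fin n) :=
  if t.val = 0 then mixingVector n m else blockVector h 1 t

theorem inner_mixingVector (hm : 1 ≤ m) (h : 2 * m ≤ n) (x : EuclideanSpace ℝ (Fin n)) :
    inner ℝ (mixingVector n m) x = (√m)⁻¹ * (x ⟨m, by omega⟩ +
      ∑ c : Fin n with 1 ≤ c.val ∧ c.val < m, x c) := by
  have hins : ({c | 1 ≤ c.val ∧ c.val ≤ m} : Finset (Fin n)) =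
      insert (⟨m, by omega⟩ : Fin n) ({c | 1 ≤ c.val ∧ c.val < m} : Finset (Fin n)) := by
    ext c
    simp only [Finset.mem_filter, Finset.mem_univ, true_and, Finset.mem_insert, Fin.ext_iff]
    omega
  rw [← Finset.sum_insert (f := fun c => x c) (by simp), ← hins, Finset.mul_sum, Finset.sum_filter]
  simp [PiLp.inner_apply, mixingVector, mul_comm]

theorem orthonormal_mixingFamily (hm : 1 ≤ m) (h : 2 * m ≤ n) :
    Orthonormal ℝ (mixingFamily h) := by
  have hmpos : (0 : ℝ) < m := by exact_mod_cast hm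
  have hu : inner ℝ (mixingVector n m) (mixingVector n m) = (1 : ℝ) := by
    have hcard : ({c | 1 ≤ c.val ∧ c.val < m} : Finset (Fin n)).card = m - 1 := by
      have : ({c | 1 ≤ c.val ∧ c.val < m} : Finset (Fin n)) =
          Finset.Ico ⟨1, by omega⟩ ⟨m, by omega⟩ := by
        ext c
        simp [Fin.le_def, Fin.lt_def]
      rw [this, Fin.card_Ico]
    have hsum : ∑ c : Fin n with 1 ≤ c.val ∧ c.val < m, mixingVector n m c =
        (m - 1 : ℝ) * (√m)⁻¹ := by
      rw [Finset.sum_congr rfl (g := fun _ => (√m)⁻¹), Finset.sum_const, hcard, nsmul_eq_mul,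
        Nat.cast_sub hm, Nat.cast_one]
      intro c hc
      simp only [Finset.mem_filter, Finset.mem_univ, true_and] at hc
      simp [mixingVector, hc.1, hc.2.le]
    rw [inner_mixingVector hm h, hsum]
    have h1 : mixingVector n m ⟨m, by omega⟩ = (√m)⁻¹ := by simp [mixingVector, hm]
    have h2 : √(m : ℝ) * √m = m := Real.mul_self_sqrt hmpos.le
    have h3 : √(m : ℝ) ≠ 0 := (Real.sqrt_pos.2 hmpos).ne'
    rw [h1]
    field_simp
    linarith
  have hub : ∀ t : Fin m, t.val ≠ 0 → inner ℝ (mixingVector n m) (blockVector h 1 t) = (0 : ℝ) := by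
    intro t ht
    have := t.2
    simp only [blockVector, EuclideanSpace.inner_single_right, mixingVector, blockIndex]
    rw [if_neg (by omega)]
    simp
  have hbb := orthonormal_iff_ite.1
    ((orthonormal_blockVector h one_ne_zero).comp Sum.inr Sum.inr_injective)
  simp only [Function.comp_def, Sum.elim_inr] at hbb
  rw [orthonormal_iff_ite]
  intro s t
  unfold mixingFamily
  split_ifs with hs ht hst hst ht hst hst
  · exact hu
  · exact absurd (Fin.ext (hs.trans ht.symm)) hst
  · exact absurd (hst ▸ hs) ht
  · exact hub t ht
  · exact absurd (hst ▸ ht) hs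
  · rw [real_inner_comm]; exact hub s hs
  · rw [hbb, if_pos hst]
  · rw [hbb, if_neg hst]

/-- The subspaces of dimension `m` whose reflections generate a group that is dense enough. -/
noncomputable def mirror (h : 2 * m ≤ n) (α : Fin m → ℝ) (j : ℕ) :
    Submodule ℝ (EuclideanSpace ℝ (Fin n)) :=
  if j = 0 then Submodule.span ℝ (Set.range (blockVector h 0))
  else if j * m < n then Submodule.span ℝ (Set.range fun t =>
    Real.cos (Real.pi * α t) • blockVector h 0 t + Real.sin (Real.pi * α t) • blockVector h j t)
  else Submodule.span ℝ (Set.range (mixingFamily h))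

theorem finrank_mirror (hm : 1 ≤ m) (h : 2 * m ≤ n) (α : Fin m → ℝ) (j : ℕ) :
    Module.finrank ℝ (mirror h α j) = m := by
  have key : ∀ v : Fin m → EuclideanSpace ℝ (Fin n), Orthonormal ℝ v →
      Module.finrank ℝ (Submodule.span ℝ (Set.range v)) = m := fun v hv => by
    simpa using finrank_span_eq_card hv.linearIndependent
  rcases eq_or_ne j 0 with h0 | h0
  · rw [mirror, if_pos h0]
    exact key _ ((orthonormal_blockVector h one_ne_zero).comp Sum.inl Sum.inl_injective)
  · rw [mirror, if_neg h0]
    by_cases h1 : j * m < n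
    · rw [if_pos h1]
      exact key _ (orthonormal_cos_smul_add_sin_smul (orthonormal_blockVector h h0) _)
    · rw [if_neg h1]
      exact key _ (orthonormal_mixingFamily hm h)

/-- The sign `ε` occurs twice in the product of two reflections and cancels. -/
theorem coordRotation_mem_of_mirror (h : 2 * m ≤ n) {α : Fin m → ℝ}
    (hα : ∀ U : Set (Fin m → ℝ), IsOpen U → U.Nonempty →
      ∃ (k : ℕ) (z : Fin m → ℤ), (fun t => k * α t + z t) ∈ U)
    {E : Set (EuclideanSpace ℝ (Fin n))} (hE : IsClosed E) {j : ℕ} (hj : j ≠ 0) (hjn : j * m < n)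
    {ε : ℝ} (hε : ε * ε = 1) (h0 : ∀ x ∈ E, ε • (mirror h α 0).reflection x ∈ E)
    (h1 : ∀ x ∈ E, ε • (mirror h α j).reflection x ∈ E) (t : Fin m) (φ : ℝ)
    {x : EuclideanSpace ℝ (Fin n)} (hx : x ∈ E) :
    coordRotation (blockIndex h 0 t) (blockIndex h j t) φ x ∈ E := by
  have hrot : ∀ y ∈ E, planesRotation (blockVector h 0) (blockVector h j)
      (fun i => 2 * (Real.pi * α i)) y ∈ E := by
    intro y hy
    rw [← reflection_comp_reflection (orthonormal_blockVector h hj)]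
    have := h1 _ (h0 y hy)
    rw [map_smul, smul_smul, hε, one_smul] at this
    simpa only [mirror, if_true, if_neg hj, if_pos hjn] using this
  have := planesRotation_mem (orthonormal_blockVector h hj) hα hE hrot (Pi.single t φ) hx
  rw [planesRotation_single] at this
  simpa [coordRotation, blockVector, EuclideanSpace.inner_single_left] using this

/-- The other members of the family are supported beyond index `m`, so only the mixing vector
contributes here. -/
theorem reflection_mixingFamily_apply (hm : 1 ≤ m) (h : 2 * m ≤ n) (x : EuclideanSpace ℝ (Fin n))
    (c : Fin n) (hc : c.val ≤ m) :
    (Submodule.span ℝ (Set.range (mixingFamily h))).reflection x c =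
      2 * inner ℝ (mixingVector n m) x * mixingVector n m c - x c := by
  rw [reflection_span_range_apply (orthonormal_mixingFamily hm h), PiLp.sub_apply,
    WithLp.ofLp_sum, Finset.sum_apply, Finset.sum_eq_single ⟨0, hm⟩]
  · simp [mixingFamily]
  · intro t _ ht
    have ht' : t.val ≠ 0 := fun h0 => ht (Fin.ext h0)
    have : blockVector h 1 t c = 0 := by
      have hne : c ≠ blockIndex h 1 t := by
        rw [Ne, Fin.ext_iff]
        simp only [blockIndex]
        omega
      simp [blockVector, hne]
    simp [mixingFamily, ht', this]
  · simp

theorem single_mem_of_mirror (hm : 1 ≤ m) (h : 2 * m ≤ n) {α : Fin m → ℝ}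
    (hα : ∀ U : Set (Fin m → ℝ), IsOpen U → U.Nonempty →
      ∃ (k : ℕ) (z : Fin m → ℤ), (fun t => k * α t + z t) ∈ U)
    {k : ℕ} (hk : ∀ c < n, c / m < k) (hk' : 2 ≤ m → ∃ q < k, n ≤ q * m) {ε : ℝ} (hε : ε * ε = 1)
    {E : Set (EuclideanSpace ℝ (Fin n))} (hsub : E ⊆ Metric.sphere 0 1) (hne : E.Nonempty)
    (hE : IsClosed E) (hinv : ∀ j < k, ∀ x ∈ E, ε • (mirror h α j).reflection x ∈ E) :
    EuclideanSpace.single (⟨0, by omega⟩ : Fin n) 1 ∈ E := by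
  have hk0 : 0 < k := (Nat.zero_le _).trans_lt (hk 0 (by omega))
  have hmm : m / m = 1 := Nat.div_self hm
  refine single_mem_of_coordRotation_mem hsub hne hE (p := ⟨m, by omega⟩)
    (T := {c | 1 ≤ c.val ∧ c.val < m}) (by simp)
    (L := fun t c => ∃ (j : ℕ) (s : Fin m), j ≠ 0 ∧ j * m < n ∧ j < k ∧
      t = blockIndex h 0 s ∧ c = blockIndex h j s) ?_ ?_ ?_ ?_ ?_ ?_
  · rintro _ _ ⟨j, s, hj, -, -, rfl, rfl⟩
    have hjm : m ≤ j * m := Nat.le_mul_of_pos_left m (Nat.pos_of_ne_zero hj)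
    have := s.2
    simp only [Ne, Fin.ext_iff, blockIndex]
    omega
  · rintro _ _ ⟨j, s, hj, hjn, hjk, rfl, rfl⟩ φ x hx
    exact coordRotation_mem_of_mirror h hα hE hj hjn hε (hinv 0 hk0) (hinv j hjk) s φ hx
  · refine ⟨1, ⟨0, hm⟩, one_ne_zero, by omega, hmm ▸ hk m (by omega), ?_, ?_⟩ <;>
      simp only [Fin.ext_iff, blockIndex] <;> omega
  · intro t ht
    simp only [Finset.mem_filter, Finset.mem_univ, true_and] at ht
    refine ⟨blockIndex h 1 ⟨t, ht.2⟩, ?_, 1, ⟨t, ht.2⟩, one_ne_zero, by omega,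
      hmm ▸ hk m (by omega), ?_, rfl⟩
    · simp only [Finset.mem_filter, Finset.mem_univ, true_and, blockIndex]
      omega
    · simp only [Fin.ext_iff, blockIndex]
      omega
  · intro c hc
    have hc' : c.val ≠ 0 := fun h0 => hc (Fin.ext h0)
    have key : m ≤ c.val → ∃ (j : ℕ) (s : Fin m), j ≠ 0 ∧ j * m < n ∧ j < k ∧
        c = blockIndex h j s := by
      intro hmc
      have h1 : c.val / m * m ≤ c.val := Nat.div_mul_le_self _ _
      have h2 : c.val < c.val / m * m + m := Nat.lt_div_mul_add hm
      have h3 : 1 ≤ c.val / m := (Nat.one_le_div_iff hm).2 hmc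
      have h4 := c.2
      -- The offset is taken from the actual start of the block, which differs from `c % m` when the
      -- block is shifted.
      refine ⟨c / m, ⟨c - min (c / m * m) (n - m), by omega⟩, by omega, by omega, hk c h4, ?_⟩
      simp only [Fin.ext_iff, blockIndex]
      omega
    rcases lt_or_ge c.val m with hcm | hcm
    · right; left
      simp only [Finset.mem_filter, Finset.mem_univ, true_and]
      omega
    · obtain ⟨j, s, hj, hjn, hjk, hcs⟩ := key hcm
      rcases eq_or_ne s.val 0 with hs | hs
      · left
        refine ⟨j, s, hj, hjn, hjk, ?_, hcs⟩
        simp only [Fin.ext_iff, blockIndex]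
        omega
      · right; right
        refine ⟨blockIndex h 0 s, ?_, j, s, hj, hjn, hjk, rfl, hcs⟩
        have := s.2
        simp only [Finset.mem_filter, Finset.mem_univ, true_and, blockIndex]
        omega
  · rintro ⟨t, ht⟩
    simp only [Finset.mem_filter, Finset.mem_univ, true_and] at ht
    obtain ⟨q, hqk, hq⟩ := hk' (by omega)
    have hq0 : q ≠ 0 := by
      rintro rfl
      omega
    have hmpos : (0 : ℝ) < √m := Real.sqrt_pos.2 (by exact_mod_cast hm)
    have hε0 : ε ≠ 0 := by
      rintro rfl
      simp at hε
    -- The mixing mirror negates coordinate 0 and, when `x` vanishes at index `m`, puts `2 / m`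
    -- times the sum over indices `1, …, m - 1` there.
    refine ⟨ε * (2 * (√m)⁻¹ * (√m)⁻¹), by positivity, fun x hx hxm => ⟨_, hinv q hqk x hx, ?_, ?_⟩⟩
    · have := reflection_mixingFamily_apply hm h x ⟨0, by omega⟩ (Nat.zero_le _)
      simp only [mirror, if_neg hq0, if_neg (not_lt.2 hq), PiLp.smul_apply, this, smul_eq_mul]
      simp only [mixingVector]
      norm_num
      linear_combination (x ⟨0, by omega⟩) ^ 2 * hε
    · have := reflection_mixingFamily_apply hm h x ⟨m, by omega⟩ le_rfl
      simp only [mirror, if_neg hq0, if_neg (not_lt.2 hq), PiLp.smul_apply, this, smul_eq_mul,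
        inner_mixingVector hm h, hxm]
      simp only [mixingVector, hm, le_refl, and_self, if_true]
      ring

end Construction

/-! ### Counting the mirrors and conclusion -/

/-- There are `⌈n / m⌉` blocks, numbered from 0, and for `m ≥ 2` the index `q = ⌈n / m⌉` is left for
the mixing mirror. -/
theorem exists_two_mul_le_and_numReflections {n i : ℕ} (hn : 2 ≤ n) (hi : 1 ≤ i) (hin : i ≤ n - 1) :
    ∃ m, 1 ≤ m ∧ 2 * m ≤ n ∧ (i = m ∨ i = n - m) ∧ (∀ c < n, c / m < numReflections n i) ∧
      (2 ≤ m → ∃ q < numReflections n i, n ≤ q * m) := by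
  have key : ∀ m : ℕ, 1 ≤ m → (∀ c < n, c / m < ⌈(n : ℝ) / m⌉₊ + 1) ∧ n ≤ ⌈(n : ℝ) / m⌉₊ * m := by
    intro m hm
    have hmpos : (0 : ℝ) < m := by exact_mod_cast hm
    have h : n ≤ ⌈(n : ℝ) / m⌉₊ * m := by
      have := Nat.le_ceil ((n : ℝ) / m)
      rw [div_le_iff₀ hmpos] at this
      exact_mod_cast this
    exact ⟨fun c hc => Nat.lt_succ_of_lt ((Nat.div_lt_iff_lt_mul hm).2 (hc.trans_le h)), h⟩
  by_cases h1 : i = 1 ∨ i + 1 = n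
  · rw [numReflections_of_eq h1]
    exact ⟨1, le_rfl, by omega, by omega, fun c hc => by simpa using hc, by omega⟩
  · rcases le_total (i : ℝ) ((n : ℝ) / 2) with h2 | h2
    · rw [numReflections_of_le (by omega) h2]
      have h3 : 2 * i ≤ n := by
        have : (2 : ℝ) * i ≤ n := by linarith
        exact_mod_cast this
      exact ⟨i, hi, h3, .inl rfl, (key i hi).1, fun _ => ⟨_, Nat.lt_succ_self _, (key i hi).2⟩⟩
    · rw [numReflections_of_ge h2 (by omega), ← Nat.cast_sub (by omega)]
      have h3 : n ≤ 2 * i := by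
        have : (n : ℝ) ≤ 2 * i := by linarith
        exact_mod_cast this
      have h4 := key (n - i) (by omega)
      exact ⟨n - i, by omega, by omega, by omega, h4.1, fun _ => ⟨_, Nat.lt_succ_self _, h4.2⟩⟩

/-- The transitivity statement for closed subsets of the unit sphere. -/
theorem exists_subspaces_eq_sphere {n i : ℕ} (hn : 2 ≤ n) (hi : 1 ≤ i) (hin : i ≤ n - 1) :
    ∃ H : Fin (numReflections n i) → Submodule ℝ (EuclideanSpace ℝ (Fin n)),
      (∀ j, Module.finrank ℝ (H j) = i) ∧
      (∀ E : Set (EuclideanSpace ℝ (Fin n)), E ⊆ Metric.sphere 0 1 → E.Nonempty → IsClosed E →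
        (∀ j, IsReflectionInvariant (H j) E) → E = Metric.sphere 0 1) := by
  obtain ⟨m, hm, h, him, hk, hk'⟩ := exists_two_mul_le_and_numReflections hn hi hin
  obtain ⟨α, hα⟩ := exists_dense_multiples (Fin m)
  -- For `i = m` take the mirrors with `ε = 1`; for `i = n - m` take their orthogonal complements
  -- with `ε = -1`.
  suffices ∃ (H : Fin (numReflections n i) → Submodule ℝ (EuclideanSpace ℝ (Fin n))) (ε : ℝ),
      (∀ j, Module.finrank ℝ (H j) = i) ∧ ε * ε = 1 ∧
        ∀ j x, (H j).reflection x = ε • (mirror h α j).reflection x by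
    obtain ⟨H, ε, hrank, hε, hrefl⟩ := this
    refine ⟨H, hrank, fun E hsub hne hE hinv => eq_sphere_of_forall_mem
      (p := EuclideanSpace.single ⟨0, by omega⟩ 1) ?_ hsub hne hE hinv⟩
    intro E hsub hne hE hinv
    refine single_mem_of_mirror hm h hα hk hk' hε hsub hne hE fun j hj x hx => ?_
    rw [← hrefl ⟨j, hj⟩]
    exact isReflectionInvariant_iff.1 (hinv _) x hx
  rcases him with rfl | rfl
  · exact ⟨fun j => mirror h α j, 1, fun j => finrank_mirror hm h α j, by norm_num, by simp⟩
  · refine ⟨fun j => (mirror h α j)ᗮ, -1, fun j => ?_, by norm_num, fun j x => ?_⟩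
    · have h1 := (mirror h α j).finrank_add_finrank_orthogonal
      rw [finrank_mirror hm, finrank_euclideanSpace_fin] at h1
      exact (Nat.sub_eq_of_eq_add' h1.symm).symm
    · rw [Submodule.reflection_orthogonal_apply, neg_one_smul]

theorem mainTheorem4 (n i : ℕ) (hn : 2 ≤ n) (hi : 1 ≤ i) (hin : i ≤ n - 1) :
    ∃ H : Fin (numReflections n i) → Submodule ℝ (EuclideanSpace ℝ (Fin n)),
      (∀ j, Module.finrank ℝ (H j) = i) ∧
      (∀ E : Set (EuclideanSpace ℝ (Fin n)), E ⊆ Metric.sphere 0 1 → E.Nonempty → IsClosed E →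
        (∀ j, IsReflectionInvariant (H j) E) → E = Metric.sphere 0 1) ∧
      (∀ F : Set (EuclideanSpace ℝ (Fin n)), IsClosed F →
        (∀ j, IsReflectionInvariant (H j) F) → IsUnionOfCentredSpheres F) ∧
      (∀ K : Set (EuclideanSpace ℝ (Fin n)), IsCompact K → Convex ℝ K → (interior K).Nonempty →
        (∀ j, IsReflectionInvariant (H j) K) →
          ∃ r : ℝ, 0 < r ∧ K = Metric.closedBall 0 r) := by
  obtain ⟨H, hrank, hH⟩ := exists_subspaces_eq_sphere hn hi hin
  have hF := fun F => isUnionOfCentredSpheres_of_eq_sphere (F := F) hH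
  exact ⟨H, hrank, hH, hF, fun K hK hconv hint hinv =>
    (hF K hK.isClosed hinv).eq_closedBall (by omega) hK hconv hint⟩
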